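/- Let $G$ be a finite group and $H \le G$ a subgroup. For $H \le U \le G$, the permutizer of $H$ in $U$ is $P_U(H) = \langle x \in U \mid \langle x\rangle H = H\langle x\rangle \rangle$. The subgroup $H$ is called permutable in $G$ if $P_G(H) = G$; strongly permutable in $G$ if $P_U(H) = U$ for every subgroup $U$ with $H \le U \le G$; and $\mathbb{P}$-subnormal in $G$ if there is a chain of subgroups $H = H_0 \le H_1 \le \dots \le H_n = G$ such that each index $|H_i : H_{i-1}|$ is $1$ or a prime. A Hall subgroup of $G$ is a subgroup whose order and index are coprime, and $G$ is supersoluble if it has a series $1 = G_0 \le G_1 \le \dots \le G_n = G$ of normal subgroups of $G$ with all factors $G_i/G_{i-1}$ cyclic. For every finite group $G$ the following statements are equivalent: 1. $G$ is supersoluble. 2. Every Hall subgroup of $G$ is $\mathbb{P}$-subnormal in $G$ or strongly permutable in $G$. 3. Every Hall subgroup of $G$ is $\mathbb{P}$-subnormal in $G$ or permutable in $G$. -/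

import Mathlib

open scoped Pointwise

namespace HallSupersoluble

/-- `G` is supersoluble: there is a finite series `1 = c 0 ≤ c 1 ≤ ... ≤ c n = G` whose terms are
normal subgroups of `G` and whose factors `c (i + 1) / c i` are cyclic. -/
def IsSupersoluble (G : Type*) [Group G] : Prop :=
  ∃ (n : ℕ) (c : ℕ → Subgroup G) (_ : ∀ i, (c i).Normal),
    c 0 = ⊥ ∧ c n = ⊤ ∧
      ∀ i < n, c i ≤ c (i + 1) ∧ IsCyclic (↥(c (i + 1)) ⧸ (c i).subgroupOf (c (i + 1)))

variable {G : Type*} [Group G]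

/-- `H` is a Hall subgroup of the finite group `G`: its order and its index are coprime. -/
def IsHall (H : Subgroup G) : Prop :=
  Nat.Coprime (Nat.card H) H.index

/-- The permutizer `P_U(H)` of `H` in `U` (used for `H ≤ U`): the subgroup generated by all
`x ∈ U` with `⟨x⟩ H = H ⟨x⟩`, an equality of product sets. -/
def permutizer (U H : Subgroup G) : Subgroup G :=
  Subgroup.closure
    {x : G | x ∈ U ∧ (Subgroup.zpowers x : Set G) * (H : Set G) = (H : Set G) * Subgroup.zpowers x}

/-- `H` is permutable in `G`: `P_G(H) = G`. -/
def IsPermutable (H : Subgroup G) : Prop :=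
  permutizer ⊤ H = ⊤

/-- `H` is strongly permutable in `G`: `P_U(H) = U` whenever `H ≤ U ≤ G`. -/
def IsStronglyPermutable (H : Subgroup G) : Prop :=
  ∀ U : Subgroup G, H ≤ U → permutizer U H = U

/-- `H` is `ℙ`-subnormal in `G`: there is a chain `H = c 0 ≤ c 1 ≤ ... ≤ c n = G` of subgroups
in which every index `|c (i + 1) : c i|` is `1` or a prime. -/
def IsPrimeSubnormal (H : Subgroup G) : Prop :=
  ∃ (n : ℕ) (c : ℕ → Subgroup G), c 0 = H ∧ c n = ⊤ ∧
    ∀ i < n, c i ≤ c (i + 1) ∧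
      ((c i).relIndex (c (i + 1)) = 1 ∨ ((c i).relIndex (c (i + 1))).Prime)

end HallSupersoluble

/-! Both nontrivial implications are inductions on the order that pass to the quotient by a normal
subgroup of prime order. A nontrivial supersoluble group has one, and pulling a chain back from the
quotient adds one step of index 1 or prime. So in a supersoluble group every subgroup, Hall or not,
is ℙ-subnormal.

For the converse, such a normal subgroup must be found from the Hall condition, which passes to
quotients because Hall subgroups lift (`IsHall.exists_map_eq`). Let p be the largest prime divisor
of |G| and P a Sylow p-subgroup. Under either alternative P is normal: by Sylow counting along a
ℙ-subnormal chain, or, if P permutes with ⟨x⟩, because P⟨x⟩ has cyclic Sylow q-subgroups for q ≠ p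
and Burnside's transfer theorem applies.

Schur–Zassenhaus gives a complement H of P, again a Hall subgroup. If H is ℙ-subnormal, its chain
cuts a normal subgroup of order p out of Z(P). If H is permutable, P is generated by elements y with
⟨y⟩ normalized by H. Automorphism groups of cyclic groups being abelian, H acts on P as an abelian
group of exponent dividing p - 1. Hence H acts by scalars on a minimal normal subgroup of G inside
Z(P), and each of its subgroups of order p is normal. -/

namespace HallSupersoluble

universe u

/-! ### Passing to quotients and back -/

section Quotients

variable {G : Type*} [Group G]

theorem isCyclic_quotient_subgroupOf_map {G' : Type*} [Group G'] {f : G →* G'} {A B : Subgroup G}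
    [A.Normal] [(A.map f).Normal] (h : IsCyclic (B ⧸ A.subgroupOf B)) :
    IsCyclic (B.map f ⧸ (A.map f).subgroupOf (B.map f)) := by
  have hle : A.subgroupOf B ≤ ((A.map f).subgroupOf (B.map f)).comap (f.subgroupMap B) := by
    intro x hx
    exact ⟨x, hx, rfl⟩
  refine isCyclic_of_surjective (QuotientGroup.map _ _ (f.subgroupMap B) hle) ?_
  exact QuotientGroup.map_surjective_of_surjective _ _ _
    ((QuotientGroup.mk'_surjective _).comp (f.subgroupMap_surjective B)) hle

theorem isCyclic_quotient_subgroupOf_comap {G' : Type*} [Group G'] {f : G →* G'}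
    {A B : Subgroup G'} [A.Normal] (h : IsCyclic (B ⧸ A.subgroupOf B)) :
    IsCyclic (B.comap f ⧸ (A.comap f).subgroupOf (B.comap f)) := by
  have hle : (A.comap f).subgroupOf (B.comap f) ≤ (A.subgroupOf B).comap (f.subgroupComap B) :=
    fun x hx => hx
  refine isCyclic_of_injective (QuotientGroup.map _ _ (f.subgroupComap B) hle) ?_
  rw [injective_iff_map_eq_one]
  intro x
  induction x using QuotientGroup.induction_on with
  | H x =>
    intro hx
    rw [QuotientGroup.map_mk, QuotientGroup.eq_one_iff] at hx
    rw [QuotientGroup.eq_one_iff]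
    exact hx

theorem IsSupersoluble.quotient (h : IsSupersoluble G) (N : Subgroup G) [N.Normal] :
    IsSupersoluble (G ⧸ N) := by
  obtain ⟨n, c, hc, h0, hn, hstep⟩ := h
  have hmap : ∀ i, ((c i).map (QuotientGroup.mk' N)).Normal := fun i =>
    (hc i).map _ (QuotientGroup.mk'_surjective N)
  refine ⟨n, fun i => (c i).map (QuotientGroup.mk' N), hmap, ?_, ?_, fun i hi => ⟨?_, ?_⟩⟩
  · simp [h0]
  · simp only [hn]
    exact Subgroup.map_top_of_surjective _ (QuotientGroup.mk'_surjective N)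
  · exact Subgroup.map_mono (hstep i hi).1
  · exact isCyclic_quotient_subgroupOf_map (hstep i hi).2

/-- An extension of a cyclic group by a supersoluble group is supersoluble. -/
theorem isSupersoluble_of_quotient (N : Subgroup G) [N.Normal] [IsCyclic N]
    (h : IsSupersoluble (G ⧸ N)) : IsSupersoluble G := by
  obtain ⟨n, c, hc, h0, hn, hstep⟩ := h
  let d : ℕ → Subgroup G
    | 0 => ⊥
    | i + 1 => (c i).comap (QuotientGroup.mk' N)
  have hd : ∀ i, (d i).Normal := by
    rintro (_ | i)
    · exact Subgroup.normal_bot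
    · exact (hc i).comap _
  refine ⟨n + 1, d, hd, rfl, ?_, ?_⟩
  · simp [d, hn]
  · rintro (_ | i) hi
    · refine ⟨bot_le, ?_⟩
      have hN : d 1 = N := by simp [d, h0, MonoidHom.comap_bot]
      change IsCyclic (↥(d 1) ⧸ (⊥ : Subgroup G).subgroupOf (d 1))
      rw [hN]
      exact isCyclic_of_surjective (QuotientGroup.mk' _) (QuotientGroup.mk'_surjective _)
    · have := hstep i (by omega)
      have := hc i
      exact ⟨Subgroup.comap_mono (hstep i (by omega)).1,
        isCyclic_quotient_subgroupOf_comap (hstep i (by omega)).2⟩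

theorem isSupersoluble_of_subsingleton [Subsingleton G] : IsSupersoluble G :=
  ⟨0, fun _ => ⊥, fun _ => inferInstance, rfl, Subsingleton.elim _ _, by simp⟩

/-- `ℙ`-subnormality passes to images under surjective homomorphisms. -/
theorem IsPrimeSubnormal.map {G' : Type*} [Group G'] {H : Subgroup G} (h : IsPrimeSubnormal H)
    {f : G →* G'} (hf : Function.Surjective f) : IsPrimeSubnormal (H.map f) := by
  obtain ⟨n, c, h0, hn, hstep⟩ := h
  refine ⟨n, fun i => (c i).map f, by simp [h0], ?_, fun i hi => ⟨Subgroup.map_mono (hstep i hi).1, ?_⟩⟩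
  · simp only [hn]
    exact Subgroup.map_top_of_surjective _ hf
  · have hdvd : ((c i).map f).relIndex ((c (i + 1)).map f) ∣ (c i).relIndex (c (i + 1)) := by
      rw [← Subgroup.relIndex_comap]
      exact Subgroup.relIndex_dvd_of_le_left _ (Subgroup.le_comap_map _ _)
    rcases (hstep i hi).2 with h1 | hp
    · left
      rw [h1] at hdvd
      exact Nat.dvd_one.mp hdvd
    · exact ((Nat.dvd_prime hp).mp hdvd).imp_right fun e => by rwa [e]

theorem IsPermutable.map {G' : Type*} [Group G'] {H : Subgroup G} (h : IsPermutable H)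
    {f : G →* G'} (hf : Function.Surjective f) : IsPermutable (H.map f) := by
  have h' : (permutizer ⊤ H).map f = ⊤ := by
    rw [h, Subgroup.map_top_of_surjective _ hf]
  refine top_unique (h'.symm.le.trans ?_)
  rw [permutizer, MonoidHom.map_closure]
  refine Subgroup.closure_mono ?_
  rintro _ ⟨x, ⟨-, hx⟩, rfl⟩
  refine ⟨Subgroup.mem_top _, ?_⟩
  rw [← MonoidHom.map_zpowers, Subgroup.coe_map, Subgroup.coe_map, ← Set.image_mul, hx,
    Set.image_mul]

/-- |HN : H| = |N : N ∩ H|, read off from |HN| = |N||H : N ∩ H| = |H||HN : H|. -/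
theorem relIndex_sup_dvd_card [Finite G] (H N : Subgroup G) [N.Normal] :
    H.relIndex (H ⊔ N) ∣ Nat.card N := by
  have h1 := Subgroup.relIndex_mul_relIndex ⊥ N (H ⊔ N) bot_le le_sup_right
  have h2 := Subgroup.relIndex_mul_relIndex ⊥ H (H ⊔ N) bot_le le_sup_left
  have h3 := Subgroup.relIndex_mul_relIndex ⊥ (N ⊓ H) H bot_le inf_le_right
  rw [Subgroup.inf_relIndex_right] at h3
  rw [Subgroup.relIndex_sup_right] at h1
  simp only [Subgroup.relIndex_bot_left] at h1 h2 h3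
  have hpos : 0 < N.relIndex H := Nat.pos_of_ne_zero fun h0 => by
    rw [h0, mul_zero] at h3
    exact Nat.card_pos.ne h3
  refine ⟨Nat.card ↥(N ⊓ H), Nat.eq_of_mul_eq_mul_right hpos ?_⟩
  rw [h1, ← h2, ← h3]
  ring

/-- If `N` is a normal subgroup of prime order and the image of `H` in `G ⧸ N` is `ℙ`-subnormal,
so is `H`. -/
theorem isPrimeSubnormal_of_quotient [Finite G] {N H : Subgroup G} [N.Normal] (hN : (Nat.card N).Prime)
    (h : IsPrimeSubnormal (H.map (QuotientGroup.mk' N))) : IsPrimeSubnormal H := by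
  obtain ⟨n, c, h0, hn, hstep⟩ := h
  let d : ℕ → Subgroup G
    | 0 => H
    | i + 1 => (c i).comap (QuotientGroup.mk' N)
  refine ⟨n + 1, d, rfl, by simp [d, hn], ?_⟩
  rintro (_ | i) hi
  · have h1 : d 1 = H ⊔ N := by
      simp only [d, h0]
      rw [Subgroup.comap_map_eq, QuotientGroup.ker_mk']
    change H ≤ d 1 ∧ (H.relIndex (d 1) = 1 ∨ (H.relIndex (d 1)).Prime)
    rw [h1]
    refine ⟨le_sup_left, ?_⟩
    have := relIndex_sup_dvd_card H N
    exact ((Nat.dvd_prime hN).mp this).imp_right fun e => by rwa [e]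
  · refine ⟨Subgroup.comap_mono (hstep i (by omega)).1, ?_⟩
    have : (d (i + 1)).relIndex (d (i + 1 + 1)) = (c i).relIndex (c (i + 1)) := by
      simp only [d]
      rw [Subgroup.relIndex_comap,
        Subgroup.map_comap_eq_self_of_surjective (QuotientGroup.mk'_surjective N)]
    rw [this]
    exact (hstep i (by omega)).2

/-- The first nontrivial term of the series lies directly above `⊥`, so it is itself cyclic, and
every subgroup of a cyclic normal subgroup is normal. -/
theorem IsSupersoluble.exists_normal_card_prime [Finite G] [Nontrivial G] (h : IsSupersoluble G) :
    ∃ N : Subgroup G, N.Normal ∧ (Nat.card N).Prime := by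
  obtain ⟨n, c, hc, h0, hn, hstep⟩ := h
  classical
  have hex : ∃ i, c i ≠ ⊥ := ⟨n, by rw [hn]; exact top_ne_bot⟩
  obtain ⟨j, hj⟩ : ∃ j, Nat.find hex = j + 1 := Nat.exists_eq_succ_of_ne_zero fun h =>
    Nat.find_spec hex (h ▸ h0)
  have hbot : c j = ⊥ := by
    by_contra hne
    exact absurd (Nat.find_min' hex hne) (by omega)
  have hne : c (j + 1) ≠ ⊥ := hj ▸ Nat.find_spec hex
  have hjn : j < n := by
    have := Nat.find_min' hex (show c n ≠ ⊥ by rw [hn]; exact top_ne_bot)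
    omega
  have hcyc : IsCyclic (c (j + 1)) := by
    have := (hstep j hjn).2
    refine isCyclic_of_injective (QuotientGroup.mk' ((c j).subgroupOf (c (j + 1)))) ?_
    rw [← MonoidHom.ker_eq_bot_iff, QuotientGroup.ker_mk', hbot, Subgroup.bot_subgroupOf]
  obtain ⟨g, hg⟩ := (Subgroup.isCyclic_iff_exists_zpowers_eq_top _).mp hcyc
  have hg1 : orderOf g ≠ 1 := by
    rw [Ne, orderOf_eq_one_iff]
    rintro rfl
    exact hne (by simpa using hg.symm)
  have hp := Nat.minFac_prime hg1
  refine ⟨Subgroup.zpowers (g ^ (orderOf g / (orderOf g).minFac)), ⟨?_⟩, ?_⟩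
  · rintro _ ⟨k, rfl⟩ x
    have hx : x * g * x⁻¹ ∈ Subgroup.zpowers g := by
      rw [hg]
      exact (hc (j + 1)).conj_mem _ (hg ▸ Subgroup.mem_zpowers g) x
    obtain ⟨l, hl⟩ := hx
    simp only at hl
    refine ⟨l * k, ?_⟩
    simp only
    rw [← conj_zpow, ← conj_pow, ← hl, zpow_mul, ← zpow_natCast, ← zpow_natCast]
    simp only [← zpow_mul]
    congr 1
    ring
  · rw [Nat.card_zpowers, orderOf_pow_orderOf_div (orderOf_pos g).ne' (Nat.minFac_dvd _)]
    exact hp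

end Quotients

/-! ### Subgroups of supersoluble groups -/

theorem IsSupersoluble.isPrimeSubnormal : ∀ (n : ℕ) {G : Type u} [Group G] [Finite G],
    Nat.card G = n → IsSupersoluble G → ∀ H : Subgroup G, IsPrimeSubnormal H := by
  intro n
  induction n using Nat.strong_induction_on with
  | _ n ih =>
    intro G _ _ hcard hG H
    rcases subsingleton_or_nontrivial G with hs | hnt
    · exact ⟨0, fun _ => H, rfl, Subsingleton.elim _ _, by simp⟩
    · obtain ⟨N, hN, hp⟩ := hG.exists_normal_card_prime
      refine isPrimeSubnormal_of_quotient hp (ih _ ?_ rfl (hG.quotient N) _)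
      rw [← hcard, Subgroup.card_eq_card_quotient_mul_card_subgroup N]
      exact lt_mul_of_one_lt_right Nat.card_pos hp.one_lt

/-! ### Normality of the Sylow subgroup for the largest prime -/

section SylowNormal

/-- If P ≠ G, the smallest prime divisor q of |G| is less than p, so its Sylow subgroup is cyclic
and Burnside's transfer theorem yields a normal q-complement M. By induction P is normal in M, hence
characteristic in M, hence normal in G. -/
theorem sylow_normal_of_isCyclic (n : ℕ) {G : Type u} [Group G] [Finite G] (hn : Nat.card G = n)
    {p : ℕ} [Fact p.Prime] (hmax : ∀ q : ℕ, q.Prime → q ∣ Nat.card G → q ≤ p)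
    (hcyc : ∀ q : ℕ, q.Prime → q ≠ p → ∀ Q : Subgroup G, IsPGroup q Q → IsCyclic Q)
    (P : Sylow p G) : (P : Subgroup G).Normal := by
  induction n using Nat.strong_induction_on generalizing G with
  | _ n ih =>
    by_cases htop : (P : Subgroup G) = ⊤
    · rw [htop]
      infer_instance
    have hidx : (P : Subgroup G).index ≠ 1 := fun h => htop (Subgroup.index_eq_one.mp h)
    obtain ⟨r, hr, hrdvd⟩ := Nat.exists_prime_and_dvd hidx
    have hrG : r ∣ Nat.card G := hrdvd.trans (Subgroup.index_dvd_card _)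
    have hrp : r ≠ p := by
      rintro rfl
      exact P.not_dvd_index hrdvd
    set q := (Nat.card G).minFac with hq
    have hqlt : q < p :=
      (Nat.minFac_le_of_dvd hr.two_le hrG).trans_lt (lt_of_le_of_ne (hmax r hr hrG) hrp)
    have hG1 : Nat.card G ≠ 1 := fun h => by
      rw [h] at hrG
      exact hr.one_lt.ne' (Nat.dvd_one.mp hrG)
    have hqp : q.Prime := Nat.minFac_prime hG1
    have : Fact q.Prime := ⟨hqp⟩
    obtain ⟨Q⟩ : Nonempty (Sylow q G) := inferInstance
    have hQ : IsCyclic Q := hcyc q hqp hqlt.ne Q Q.isPGroup'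
    have hcompl := IsCyclic.isComplement' hq.symm hQ
    set M := (MonoidHom.transferSylow Q (hQ.normalizer_le_centralizer hq.symm)).ker
    have hMnormal : M.Normal := MonoidHom.normal_ker _
    have hMidx : M.index = Nat.card Q := hcompl.symm.index_eq_card
    obtain ⟨k, hk⟩ := IsPGroup.iff_card.mp Q.isPGroup'
    obtain ⟨l, hl⟩ := IsPGroup.iff_card.mp P.isPGroup'
    -- The index of P ∩ M in P is both a power of p and a divisor of |G : M|, a power of q.
    have hPM : (P : Subgroup G) ≤ M := by
      rw [← Subgroup.relIndex_eq_one]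
      refine Nat.eq_one_of_dvd_coprimes (?_ : Nat.Coprime (q ^ k) (p ^ l)) ?_ ?_
      · exact Nat.Coprime.pow _ _ ((Nat.coprime_primes hqp Fact.out).mpr hqlt.ne)
      · rw [← hk, ← hMidx]
        exact Subgroup.relIndex_dvd_index_of_normal _ _
      · rw [← hl]
        exact Subgroup.relIndex_dvd_card _ _
    have hMlt : Nat.card M < n := by
      rw [← hn, ← M.card_mul_index, hMidx]
      refine lt_mul_of_one_lt_right Nat.card_pos ?_
      exact hqp.one_lt.trans_le
        (Nat.le_of_dvd Nat.card_pos (Q.dvd_card_of_dvd_card (Nat.minFac_dvd _)))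
    have hnorm : ((P.subtype hPM : Sylow p M) : Subgroup M).Normal := by
      refine ih _ hMlt rfl (fun r hr hrM => hmax r hr (hrM.trans (Subgroup.card_subgroup_dvd_card M)))
        (fun r hr hrp R hR => ?_) _
      have := hcyc r hr hrp _ (hR.map M.subtype)
      exact isCyclic_of_injective (R.equivMapOfInjective _ M.subtype_injective).toMonoidHom
        (R.equivMapOfInjective _ M.subtype_injective).injective
    have hchar := Sylow.characteristic_of_normal _ hnorm
    have := ConjAct.normal_of_characteristic_of_normal (K := ((P.subtype hPM : Sylow p M) : Subgroup M))
    rwa [Sylow.coe_subtype, Subgroup.subgroupOf_map_subtype, inf_eq_left.mpr hPM] at this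

variable {G : Type u} [Group G]

theorem coe_sup_of_mul_comm {A B : Subgroup G} (h : (A : Set G) * B = B * A) :
    ((A ⊔ B : Subgroup G) : Set G) = A * B := by
  refine subset_antisymm ?_ ?_
  have hmul : ∀ x ∈ (A : Set G) * B, ∀ y ∈ (A : Set G) * B, x * y ∈ (A : Set G) * B := by
    rintro _ ⟨a, ha, b, hb, rfl⟩ _ ⟨a', ha', b', hb', rfl⟩
    have : b * a' ∈ (A : Set G) * B := h ▸ Set.mul_mem_mul hb ha'
    obtain ⟨a'', ha'', b'', hb'', h2⟩ := this
    refine ⟨a * a'', A.mul_mem ha ha'', b'' * b', B.mul_mem hb'' hb', ?_⟩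
    simp only at h2 ⊢
    rw [mul_assoc a b, ← mul_assoc b, ← h2]
    group
  let S : Subgroup G :=
    { carrier := (A : Set G) * B
      one_mem' := ⟨1, A.one_mem, 1, B.one_mem, mul_one 1⟩
      mul_mem' := fun {x y} hx hy => hmul x hx y hy
      inv_mem' := by
        rintro _ ⟨a, ha, b, hb, rfl⟩
        rw [h]
        exact ⟨b⁻¹, B.inv_mem hb, a⁻¹, A.inv_mem ha, (mul_inv_rev a b).symm⟩ }
  have hle : A ⊔ B ≤ S := sup_le (fun a ha => ⟨a, ha, 1, B.one_mem, mul_one a⟩)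
    (fun b hb => ⟨1, A.one_mem, b, hb, one_mul b⟩)
  · exact hle
  · rintro _ ⟨a, ha, b, hb, rfl⟩
    exact Subgroup.mul_mem_sup ha hb

/-- Since the join is BA, every coset of A in it has a representative in B; so its index equals |B :
A ∩ B|. -/
theorem relIndex_sup_of_mul_comm [Finite G] {A B : Subgroup G} (h : (A : Set G) * B = B * A) :
    A.relIndex (A ⊔ B) ∣ Nat.card B := by
  have hbij : Function.Bijective
      (Subgroup.quotientSubgroupOfEmbeddingOfLE A (le_sup_right : B ≤ A ⊔ B)) := by
    refine ⟨Function.Embedding.injective _, fun x => ?_⟩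
    induction x using QuotientGroup.induction_on with
    | H x =>
      obtain ⟨x, hx⟩ := x
      have hx' : x ∈ (B : Set G) * A := by
        rw [← h, ← coe_sup_of_mul_comm h]
        exact hx
      obtain ⟨b, hb, a, ha, rfl⟩ := hx'
      refine ⟨QuotientGroup.mk ⟨b, hb⟩, ?_⟩
      rw [Subgroup.quotientSubgroupOfEmbeddingOfLE_apply_mk, QuotientGroup.eq]
      simpa [Subgroup.mem_subgroupOf] using ha
  have : A.relIndex B = A.relIndex (A ⊔ B) := Nat.card_congr (Equiv.ofBijective _ hbij)
  rw [← this]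
  exact Subgroup.relIndex_dvd_card _ _

/-- In K = P⟨x⟩ the index |K : P| divides the order of x. For q ≠ p the full q-part of |K| therefore
divides that order, so a power of x generates a Sylow q-subgroup of K, and
`sylow_normal_of_isCyclic` applies to K. -/
theorem mem_normalizer_of_mul_comm [Finite G] {p : ℕ} [Fact p.Prime]
    (hmax : ∀ q : ℕ, q.Prime → q ∣ Nat.card G → q ≤ p) (P : Sylow p G) {x : G}
    (hx : (Subgroup.zpowers x : Set G) * (P : Set G) = (P : Set G) * Subgroup.zpowers x) :
    x ∈ Subgroup.normalizer (P : Set G) := by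
  set K : Subgroup G := P ⊔ Subgroup.zpowers x with hK
  have hPK : (P : Subgroup G) ≤ K := le_sup_left
  have hxK : x ∈ K := (le_sup_right : Subgroup.zpowers x ≤ K) (Subgroup.mem_zpowers x)
  have hdvd : (P : Subgroup G).relIndex K ∣ orderOf x := by
    rw [← Nat.card_zpowers]
    exact relIndex_sup_of_mul_comm hx.symm
  have hcard : Nat.card (P : Subgroup G) * (P : Subgroup G).relIndex K = Nat.card K := by
    rw [← Subgroup.relIndex_bot_left, ← Subgroup.relIndex_bot_left]
    exact Subgroup.relIndex_mul_relIndex _ _ _ bot_le hPK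
  have hnorm : ((P.subtype hPK : Sylow p K) : Subgroup K).Normal := by
    refine sylow_normal_of_isCyclic _ rfl
      (fun r hr hrK => hmax r hr (hrK.trans (Subgroup.card_subgroup_dvd_card K)))
      (fun q hq hqp Q hQ => ?_) _
    have : Fact q.Prime := ⟨hq⟩
    set a := (Nat.card K).factorization q with ha
    obtain ⟨l, hl⟩ := IsPGroup.iff_card.mp P.isPGroup'
    have hqa : q ^ a ∣ orderOf x := by
      refine (Nat.Coprime.dvd_of_dvd_mul_left (m := p ^ l) ?_ ?_).trans hdvd
      · exact Nat.Coprime.pow _ _ ((Nat.coprime_primes hq Fact.out).mpr hqp)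
      · rw [← hl, hcard]
        exact Nat.ordProj_dvd _ _
    let y : K := ⟨x, hxK⟩ ^ (orderOf x / q ^ a)
    have hy : Nat.card (Subgroup.zpowers y) = q ^ a := by
      have h1 : orderOf (⟨x, hxK⟩ : K) = orderOf x := Subgroup.orderOf_mk x hxK
      rw [Nat.card_zpowers]
      change orderOf ((⟨x, hxK⟩ : K) ^ (orderOf x / q ^ a)) = q ^ a
      rw [← h1] at hqa ⊢
      exact orderOf_pow_orderOf_div (orderOf_pos _).ne' hqa
    obtain ⟨S, hS⟩ := hQ.exists_le_sylow
    let T : Sylow q K := Sylow.ofCard (Subgroup.zpowers y) hy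
    have hT : IsCyclic T := inferInstanceAs (IsCyclic (Subgroup.zpowers y))
    have hS' : IsCyclic S := isCyclic_of_injective (S.equiv T).toMonoidHom (S.equiv T).injective
    exact isCyclic_of_injective (Subgroup.inclusion hS) (Subgroup.inclusion_injective hS)
  rw [Sylow.coe_subtype] at hnorm
  exact Subgroup.le_normalizer_of_normal_subgroupOf hPK hxK

/-- Normality of P climbs the chain. If P is normal in one term, the number of Sylow p-subgroups of
the next divides 1 or a prime r ≤ p; being congruent to 1 mod p, it cannot be r. -/
theorem IsPrimeSubnormal.sylow_normal [Finite G] {p : ℕ} [Fact p.Prime]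
    (hmax : ∀ q : ℕ, q.Prime → q ∣ Nat.card G → q ≤ p) (P : Sylow p G)
    (h : IsPrimeSubnormal (P : Subgroup G)) : (P : Subgroup G).Normal := by
  obtain ⟨n, c, h0, hn, hstep⟩ := h
  have hle : ∀ i ≤ n, (P : Subgroup G) ≤ c i := by
    intro i hi
    induction i with
    | zero => exact h0.ge
    | succ i ih => exact (ih (by omega)).trans (hstep i (by omega)).1
  have key : ∀ i ≤ n, c i ≤ Subgroup.normalizer ((P : Subgroup G) : Set G) := by
    intro i hi
    induction i with
    | zero => exact h0 ▸ Subgroup.le_normalizer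
    | succ i ih =>
      set K := c (i + 1) with hK
      have hPK := hle (i + 1) hi
      let PK : Sylow p K := P.subtype hPK
      have hsub : (c i).subgroupOf K ≤ Subgroup.normalizer ((PK : Subgroup K) : Set K) := by
        change _ ≤ Subgroup.normalizer (((P : Subgroup G).subgroupOf K : Subgroup K) : Set K)
        rw [← Subgroup.subgroupOf_normalizer_eq hPK]
        exact Subgroup.comap_mono (ih (by omega))
      have hdvd : (Subgroup.normalizer ((PK : Subgroup K) : Set K)).index ∣ (c i).relIndex K :=
        Subgroup.index_dvd_of_le hsub
      have hone : (Subgroup.normalizer ((PK : Subgroup K) : Set K)).index = 1 := by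
        rcases (hstep i (by omega)).2 with h1 | hr
        · rw [h1] at hdvd
          exact Nat.dvd_one.mp hdvd
        · rcases (Nat.dvd_prime hr).mp hdvd with h1 | h1
          · exact h1
          · exfalso
            have hmod := card_sylow_modEq_one p K
            rw [PK.card_eq_index_normalizer] at hmod
            change (Subgroup.normalizer ((PK : Subgroup K) : Set K)).index ≡ 1 [MOD p] at hmod
            rw [h1] at hmod
            have hrp : (c i).relIndex K ≤ p := hmax _ hr
              ((Subgroup.relIndex_dvd_card _ _).trans (Subgroup.card_subgroup_dvd_card K))
            have hp1 : 1 < p := (Fact.out : p.Prime).one_lt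
            rcases hrp.eq_or_lt with heq | hlt
            · rw [heq, Nat.ModEq, Nat.mod_self, Nat.mod_eq_of_lt hp1] at hmod
              exact zero_ne_one hmod
            · exact hr.one_lt.ne' (hmod.eq_of_lt_of_lt hlt hp1)
      have hnorm : (PK : Subgroup K).Normal :=
        Subgroup.normalizer_eq_top_iff.mp (Subgroup.index_eq_one.mp hone)
      have : ((P : Subgroup G).subgroupOf K).Normal := hnorm
      exact Subgroup.le_normalizer_of_normal_subgroupOf hPK
  rw [← Subgroup.normalizer_eq_top_iff, eq_top_iff, ← hn]
  exact key n le_rfl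

theorem IsPermutable.sylow_normal [Finite G] {p : ℕ} [Fact p.Prime]
    (hmax : ∀ q : ℕ, q.Prime → q ∣ Nat.card G → q ≤ p) (P : Sylow p G)
    (h : IsPermutable (P : Subgroup G)) : (P : Subgroup G).Normal := by
  rw [← Subgroup.normalizer_eq_top_iff, eq_top_iff, ← h, permutizer, Subgroup.closure_le]
  rintro x ⟨-, hx⟩
  exact mem_normalizer_of_mul_comm hmax P hx

end SylowNormal

/-! ### An eigenvector over the prime field -/

section Eigenvector

open Polynomial in
-- View A as a vector space over the field of p elements. T is annihilated by X^p - X, which splits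
-- there, so its minimal polynomial has a root; k lifts that eigenvalue to ℕ.
theorem exists_map_eq_pow {A : Type*} [CommGroup A] [Finite A] [Nontrivial A] {p : ℕ}
    [Fact p.Prime] (hA : ∀ a : A, a ^ p = 1) (T : A →* A) (hT : ∀ a, T^[p] a = T a) :
    ∃ k : ℕ, ∃ a : A, a ≠ 1 ∧ T a = a ^ k := by
  let _ : Module (ZMod p) (Additive A) := AddCommGroup.zmodModule (n := p) fun a => hA a.toMul
  let f : Module.End (ZMod p) (Additive A) := (MonoidHom.toAdditive T).toZModLinearMap p
  have hf : ∀ (n : ℕ) (a : Additive A), (f ^ n) a = Additive.ofMul (T^[n] a.toMul) := by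
    intro n
    induction n with
    | zero => intro a; rfl
    | succ n ih =>
      intro a
      rw [pow_succ, Function.iterate_succ_apply]
      exact ih _
  have hann : aeval f (X ^ p - X : (ZMod p)[X]) = 0 := by
    rw [map_sub, map_pow, aeval_X, sub_eq_zero]
    ext a
    rw [hf, hT]
    rfl
  have hp1 : 1 < p := (Fact.out : p.Prime).one_lt
  have hsplit : (minpoly (ZMod p) f).Splits :=
    (GaloisField.splits_zmod_X_pow_sub_X p).of_dvd (FiniteField.X_pow_card_sub_X_ne_zero _ hp1)
      (minpoly.dvd _ _ hann)
  have hint : IsIntegral (ZMod p) f := Algebra.IsIntegral.isIntegral f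
  obtain ⟨μ, hμ⟩ := hsplit.exists_eval_eq_zero (minpoly.degree_pos hint).ne'
  obtain ⟨v, hv⟩ := (Module.End.hasEigenvalue_of_isRoot hμ).exists_hasEigenvector
  refine ⟨μ.val, v.toMul, fun h => hv.2 h, ?_⟩
  have h1 : f v = μ • v := hv.apply_eq_smul
  have h2 : μ • v = μ.val • v := by
    rw [← Nat.cast_smul_eq_nsmul (ZMod p), ZMod.natCast_zmod_val]
  exact h1.trans h2

end Eigenvector

/-! ### Action on a normalized cyclic subgroup -/

section CyclicNormalizer

variable {G : Type u} [Group G]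

/-- The automorphism group of a cyclic group is abelian, so commutators act trivially on ⟨y⟩. -/
theorem commute_commutator_of_mem_normalizer_zpowers {y h k : G}
    (hh : h ∈ Subgroup.normalizer (Subgroup.zpowers y : Set G))
    (hk : k ∈ Subgroup.normalizer (Subgroup.zpowers y : Set G)) : Commute (h * k * h⁻¹ * k⁻¹) y := by
  let φ := (Subgroup.zpowers y).normalizerMonoidHom
  let e := IsCyclic.mulAutMulEquiv (Subgroup.zpowers y)
  let h' : (Subgroup.normalizer (Subgroup.zpowers y : Set G)) := ⟨h, hh⟩
  let k' : (Subgroup.normalizer (Subgroup.zpowers y : Set G)) := ⟨k, hk⟩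
  have hker : h' * k' * h'⁻¹ * k'⁻¹ ∈ φ.ker := by
    rw [MonoidHom.mem_ker]
    apply e.injective
    simp only [map_mul, map_inv, map_one]
    rw [mul_comm (e (φ h'))]
    group
  rw [Subgroup.normalizerMonoidHom_ker, Subgroup.mem_subgroupOf,
    Subgroup.mem_centralizer_iff] at hker
  exact (hker y (Subgroup.mem_zpowers y)).symm

/-- The automorphism group of ⟨y⟩ has order p^(a-1)(p-1) for a > 0, and the automorphism induced by
h has order prime to p. -/
theorem commute_pow_of_mem_normalizer_zpowers [Finite G] {p a : ℕ} [Fact p.Prime] {y h : G}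
    (hy : orderOf y = p ^ a) (hh : h ∈ Subgroup.normalizer (Subgroup.zpowers y : Set G))
    (hcop : (orderOf h).Coprime p) : Commute (h ^ (p - 1)) y := by
  let φ := (Subgroup.zpowers y).normalizerMonoidHom
  let h' : (Subgroup.normalizer (Subgroup.zpowers y : Set G)) := ⟨h, hh⟩
  have hker : h' ^ (p - 1) ∈ φ.ker := by
    rw [MonoidHom.mem_ker, map_pow, ← orderOf_dvd_iff_pow_eq_one]
    have h1 : orderOf (φ h') ∣ orderOf h := by
      rw [← Subgroup.orderOf_mk h hh]
      exact orderOf_map_dvd φ h'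
    have h2 : orderOf (φ h') ∣ (p ^ a).totient := by
      rw [← hy, ← Nat.card_zpowers y, ← IsCyclic.card_mulAut]
      exact orderOf_dvd_natCard _
    rcases Nat.eq_zero_or_pos a with rfl | ha
    · rw [pow_zero, Nat.totient_one] at h2
      exact h2.trans (one_dvd _)
    · rw [Nat.totient_prime_pow Fact.out ha] at h2
      exact ((hcop.coprime_dvd_left h1).pow_right _).dvd_of_dvd_mul_left h2
  rw [Subgroup.normalizerMonoidHom_ker, Subgroup.mem_subgroupOf,
    Subgroup.mem_centralizer_iff] at hker
  exact (hker y (Subgroup.mem_zpowers y)).symm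

end CyclicNormalizer

/-! ### Normal subgroup of order p: ℙ-subnormal complement -/

section MinimalNormal

variable {G : Type u} [Group G]

theorem sup_le_normalizer_normal {P H N : Subgroup G} (hsup : P ⊔ H = ⊤)
    (hP : P ≤ Subgroup.normalizer (N : Set G)) (hH : H ≤ Subgroup.normalizer (N : Set G)) :
    N.Normal := by
  rw [← Subgroup.normalizer_eq_top_iff, eq_top_iff, ← hsup]
  exact sup_le hP hH

/-- The centre of a subgroup `P`, as a subgroup of the whole group. -/
def centerIn (P : Subgroup G) : Subgroup G :=
  (Subgroup.center P).map P.subtype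

theorem mem_centerIn {P : Subgroup G} {x : G} :
    x ∈ centerIn P ↔ x ∈ P ∧ ∀ y ∈ P, y * x = x * y := by
  constructor
  · rintro ⟨z, hz, rfl⟩
    exact ⟨z.2, fun y hy => congrArg Subtype.val (Subgroup.mem_center_iff.mp hz ⟨y, hy⟩)⟩
  · rintro ⟨hx, hc⟩
    exact ⟨⟨x, hx⟩, Subgroup.mem_center_iff.mpr fun y => Subtype.ext (hc y y.2), rfl⟩

instance centerIn_normal (P : Subgroup G) [P.Normal] : (centerIn P).Normal :=
  ConjAct.normal_of_characteristic_of_normal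

theorem le_normalizer_of_le_centerIn {P N : Subgroup G} (hN : N ≤ centerIn P) :
    P ≤ Subgroup.normalizer (N : Set G) := by
  rw [Subgroup.le_normalizer_iff]
  intro x hx n hn
  rwa [(mem_centerIn.mp (hN hn)).2 x hx, mul_inv_cancel_right]

variable [Finite G] {p : ℕ} [Fact p.Prime]

theorem centerIn_ne_bot {P : Subgroup G} (hP : IsPGroup p P) (hne : P ≠ ⊥) : centerIn P ≠ ⊥ := by
  have : Nontrivial P := (Subgroup.nontrivial_iff_ne_bot P).mpr hne
  intro h
  refine hP.bot_lt_center.ne' ?_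
  rwa [centerIn, Subgroup.map_eq_bot_iff_of_injective _ P.subtype_injective] at h

/-- Take the first chain term `c (j + 1)` that meets Z(P) nontrivially. Elements of this
intersection lie in distinct cosets of `c j`, so its order is at most the index of that step. The
index divides |P| = |G : H|, so it is p. P normalizes the intersection by centrality, and H does
because H ≤ `c (j + 1)`. -/
theorem IsPrimeSubnormal.exists_normal_card_eq {P H : Subgroup G} [P.Normal] (hP : IsPGroup p P)
    (hne : P ≠ ⊥) (hPH : Subgroup.IsComplement' P H) (h : IsPrimeSubnormal H) :
    ∃ N : Subgroup G, N.Normal ∧ Nat.card N = p := by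
  obtain ⟨n, c, h0, hn, hstep⟩ := h
  have hZ := centerIn_ne_bot hP hne
  have hZP : centerIn P ≤ P := fun x hx => (mem_centerIn.mp hx).1
  classical
  have htop : centerIn P ⊓ c n ≠ ⊥ := by rwa [hn, inf_top_eq]
  have hex : ∃ i, centerIn P ⊓ c i ≠ ⊥ := ⟨n, htop⟩
  have hzero : centerIn P ⊓ c 0 = ⊥ := by
    rw [h0]
    exact (hPH.disjoint.mono_left hZP).eq_bot
  obtain ⟨j, hj⟩ : ∃ j, Nat.find hex = j + 1 := Nat.exists_eq_succ_of_ne_zero fun h =>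
    Nat.find_spec hex (h ▸ hzero)
  have hbot : centerIn P ⊓ c j = ⊥ := by
    by_contra hne
    exact absurd (Nat.find_min' hex hne) (by omega)
  have hnebot : centerIn P ⊓ c (j + 1) ≠ ⊥ := hj ▸ Nat.find_spec hex
  have hjn : j < n := by
    have := Nat.find_min' hex htop
    omega
  have hHle : ∀ i ≤ n, H ≤ c i := by
    intro i hi
    induction i with
    | zero => exact h0.ge
    | succ i ih => exact (ih (by omega)).trans (hstep i (by omega)).1
  have hcard : Nat.card ↥(centerIn P ⊓ c (j + 1)) ≤ (c j).relIndex (c (j + 1)) := by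
    rw [← Subgroup.relIndex_bot_left, ← hbot]
    have : (centerIn P ⊓ c j).relIndex (centerIn P ⊓ c (j + 1)) =
        (c j).relIndex (centerIn P ⊓ c (j + 1)) := by
      rw [← Subgroup.inf_relIndex_right (c j), ← inf_assoc, inf_comm (c j), inf_assoc,
        inf_eq_left.mpr (hstep j hjn).1]
    rw [this]
    exact Subgroup.relIndex_le_of_le_right inf_le_right
      Subgroup.index_ne_zero_of_finite
  have hpg : IsPGroup p ↥(centerIn P ⊓ c (j + 1)) := hP.to_le (inf_le_left.trans hZP)
  have hpdvd : p ∣ Nat.card ↥(centerIn P ⊓ c (j + 1)) :=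
    hpg.card_eq_or_dvd.resolve_left fun h => hnebot (Subgroup.card_eq_one.mp h)
  have hidx : (c j).relIndex (c (j + 1)) ∣ Nat.card P := by
    rw [← hPH.index_eq_card]
    refine (Subgroup.relIndex_dvd_index_of_le (hstep j hjn).1).trans ?_
    exact Subgroup.index_dvd_of_le (hHle j hjn.le)
  have hrel : (c j).relIndex (c (j + 1)) = p := by
    rcases (hstep j hjn).2 with h1 | hr
    · rw [h1] at hcard
      exact absurd (Nat.le_of_dvd Nat.card_pos hpdvd)
        (not_le.mpr (hcard.trans_lt (Fact.out : p.Prime).one_lt))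
    · obtain ⟨l, hl⟩ := IsPGroup.iff_card.mp hP
      exact (Nat.prime_dvd_prime_iff_eq hr Fact.out).mp (hr.dvd_of_dvd_pow (hl ▸ hidx))
  refine ⟨centerIn P ⊓ c (j + 1), sup_le_normalizer_normal hPH.sup_eq_top
    (le_normalizer_of_le_centerIn inf_le_left) ?_,
    le_antisymm (hrel ▸ hcard) (Nat.le_of_dvd Nat.card_pos hpdvd)⟩
  rw [Subgroup.le_normalizer_iff]
  intro x hx n hn
  have hxc := hHle (j + 1) hjn hx
  exact ⟨(centerIn_normal P).conj_mem n hn.1 x,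
    (c (j + 1)).mul_mem ((c (j + 1)).mul_mem hxc hn.2) ((c (j + 1)).inv_mem hxc)⟩

end MinimalNormal

/-! ### Normal subgroup of order p: permutable complement -/

section PermutableComplement

variable {G : Type u} [Group G] [Finite G] {p : ℕ} [Fact p.Prime]

/-- If a complement `H` of the normal Sylow subgroup `P` permutes with `⟨x⟩`, then `x` lies in
`H⟨y⟩` for some `y ∈ P` such that `H` normalizes `⟨y⟩`. -/
theorem exists_mem_sup_zpowers_of_mul_comm {P H : Subgroup G} [P.Normal] (hP : IsPGroup p P)
    (hpP : ¬ p ∣ Nat.card H) (hPH : Subgroup.IsComplement' P H) {x : G}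
    (hx : (Subgroup.zpowers x : Set G) * (H : Set G) = (H : Set G) * Subgroup.zpowers x) :
    ∃ y ∈ P, H ≤ Subgroup.normalizer (Subgroup.zpowers y : Set G) ∧
      x ∈ H ⊔ Subgroup.zpowers y := by
  set K := H ⊔ Subgroup.zpowers x with hK
  have hxK : x ∈ K := (le_sup_right : Subgroup.zpowers x ≤ K) (Subgroup.mem_zpowers x)
  have hHK : H ≤ K := le_sup_left
  have hcopH : ∀ k, (p ^ k).Coprime (Nat.card H) := fun k =>
    ((Nat.Prime.coprime_iff_not_dvd Fact.out).mpr hpP).pow_left k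
  have hdvd : H.relIndex K ∣ orderOf x := by
    rw [← Nat.card_zpowers]
    exact relIndex_sup_of_mul_comm hx.symm
  have hcard : Nat.card H * H.relIndex K = Nat.card K := by
    rw [← Subgroup.relIndex_bot_left, ← Subgroup.relIndex_bot_left]
    exact Subgroup.relIndex_mul_relIndex _ _ _ bot_le hHK
  set a := (orderOf x).factorization p with ha
  -- y generates the Sylow p-subgroup of ⟨x⟩.
  set y := x ^ (orderOf x / p ^ a) with hy
  have hyord : orderOf y = p ^ a :=
    orderOf_pow_orderOf_div (orderOf_pos x).ne' (Nat.ordProj_dvd _ _)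
  have hycard : Nat.card (Subgroup.zpowers y) = p ^ a := by rw [Nat.card_zpowers, hyord]
  have hyP : y ∈ P := by
    have hind : ¬ p ∣ P.index := by rwa [hPH.symm.index_eq_card]
    let S : Sylow p G := hP.toSylow hind
    have hSn : (S : Subgroup G).Normal := by assumption
    have := Sylow.unique_of_normal S hSn
    obtain ⟨T, hT⟩ := (IsPGroup.of_card hycard).exists_le_sylow
    have hTS : T = S := Subsingleton.elim _ _
    have : y ∈ S := hTS ▸ hT (Subgroup.mem_zpowers y)
    exact this
  have hyK : y ∈ K := K.pow_mem hxK _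
  have hle : Subgroup.zpowers y ≤ P ⊓ K := by
    rw [Subgroup.zpowers_le]
    exact ⟨hyP, hyK⟩
  -- |P ∩ K| is a power of p dividing |K| = |H||K : H|, hence divides |K : H| and so the order of x.
  -- As P ∩ K is normal in K, H normalizes ⟨y⟩.
  have hQ : Subgroup.zpowers y = P ⊓ K := by
    refine Subgroup.eq_of_le_of_card_ge hle ?_
    rw [hycard]
    obtain ⟨b, hb⟩ := IsPGroup.iff_card.mp (hP.to_le (inf_le_left : P ⊓ K ≤ P))
    rw [hb]
    have hbx : p ^ b ∣ orderOf x := by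
      refine ((hcopH b).dvd_of_dvd_mul_left ?_).trans hdvd
      rw [hcard, ← hb]
      exact Subgroup.card_dvd_of_le inf_le_right
    exact Nat.pow_le_pow_right (Fact.out : p.Prime).pos
      (((Fact.out : p.Prime).pow_dvd_iff_le_factorization (orderOf_pos x).ne').mp hbx)
  refine ⟨y, hyP, ?_, ?_⟩
  · rw [Subgroup.le_normalizer_iff, hQ]
    rintro h hh k ⟨hkP, hkK⟩
    exact ⟨‹P.Normal›.conj_mem k hkP h, K.mul_mem (K.mul_mem (hHK hh) hkK) (K.inv_mem (hHK hh))⟩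
  · have hle : H ⊔ Subgroup.zpowers y ≤ K := sup_le hHK (by rwa [Subgroup.zpowers_le])
    have hrel : H.relIndex K ∣ p ^ a := by
      have h1 : H.relIndex K ∣ Nat.card P := by
        rw [← hPH.index_eq_card]
        exact Subgroup.relIndex_dvd_index_of_le hHK
      obtain ⟨l, hl⟩ := IsPGroup.iff_card.mp hP
      rw [hl] at h1
      obtain ⟨r, -, hr⟩ := (Nat.dvd_prime_pow Fact.out).mp h1
      rw [hr] at hdvd ⊢
      exact pow_dvd_pow p
        (((Fact.out : p.Prime).pow_dvd_iff_le_factorization (orderOf_pos x).ne').mp hdvd)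
    have heq : H ⊔ Subgroup.zpowers y = K := by
      refine Subgroup.eq_of_le_of_card_ge hle (Nat.le_of_dvd Nat.card_pos ?_)
      rw [← hcard]
      refine (mul_dvd_mul_left _ hrel).trans ?_
      refine Nat.Coprime.mul_dvd_of_dvd_of_dvd (hcopH a).symm (Subgroup.card_dvd_of_le le_sup_left) ?_
      rw [← hycard]
      exact Subgroup.card_dvd_of_le le_sup_right
    rw [heq]
    exact hxK

/-- A normal subgroup `P` with a permutable complement `H` is generated by the elements `y` such
that `H` normalizes `⟨y⟩`. -/
theorem IsPermutable.closure_eq {P H : Subgroup G} [P.Normal] (hP : IsPGroup p P)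
    (hpP : ¬ p ∣ Nat.card H) (hPH : Subgroup.IsComplement' P H) (h : IsPermutable H) :
    Subgroup.closure {y | y ∈ P ∧ H ≤ Subgroup.normalizer (Subgroup.zpowers y : Set G)} = P := by
  set L := Subgroup.closure {y | y ∈ P ∧ H ≤ Subgroup.normalizer (Subgroup.zpowers y : Set G)}
    with hL
  have hLP : L ≤ P := by
    rw [hL, Subgroup.closure_le]
    exact fun y hy => hy.1
  have hnorm : H ≤ Subgroup.normalizer (L : Set G) := by
    rw [hL, Subgroup.le_normalizer_closure_iff]
    intro x hx y hy
    have h1 : x * y * x⁻¹ ∈ Subgroup.zpowers y :=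
      (hy.2 hx y).mp (Subgroup.mem_zpowers y)
    exact (Subgroup.zpowers_le.mpr (Subgroup.subset_closure hy)) h1
  have htop : H ⊔ L = ⊤ := by
    rw [eq_top_iff, ← h, permutizer, Subgroup.closure_le]
    rintro x ⟨-, hx⟩
    obtain ⟨y, hy, hyH, hxy⟩ := exists_mem_sup_zpowers_of_mul_comm hP hpP hPH hx
    have hyL : y ∈ L := Subgroup.subset_closure ⟨hy, hyH⟩
    exact (sup_le_sup_left (Subgroup.zpowers_le.mpr hyL) H) hxy
  have hcomm : (H : Set G) * L = L * H := by
    ext g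
    constructor
    · rintro ⟨x, hx, y, hy, rfl⟩
      exact ⟨x * y * x⁻¹, (hnorm hx y).mp hy, x, hx, by simp⟩
    · rintro ⟨y, hy, x, hx, rfl⟩
      refine ⟨x, hx, x⁻¹ * y * x, ?_, by simp [mul_assoc]⟩
      simpa using (hnorm (H.inv_mem hx) y).mp hy
  refine le_antisymm hLP fun g hg => ?_
  have hmem : g ∈ ((H ⊔ L : Subgroup G) : Set G) := by
    rw [htop]
    trivial
  rw [coe_sup_of_mul_comm hcomm] at hmem
  obtain ⟨x, hx, y, hy, rfl⟩ := hmem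
  -- Dedekind's argument: G = HL with L ≤ P and H ∩ P = 1 forces P = L.
  have hxP : x ∈ P := by
    have := P.mul_mem hg (P.inv_mem (hLP hy))
    simpa using this
  have hx1 : x = 1 := Subgroup.mem_bot.mp (hPH.disjoint.le_bot ⟨hxP, hx⟩)
  simpa [hx1] using hy

/-- Commutators and (p-1)-th powers of elements of H centralize the generators of P given by
`IsPermutable.closure_eq`, hence all of P. On a minimal normal subgroup N of G inside Z(P), each
element of H then has an eigenvector, and minimality makes its eigenspace all of N. -/
theorem IsPermutable.exists_normal_card_eq {P H : Subgroup G} [P.Normal] (hP : IsPGroup p P)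
    (hne : P ≠ ⊥) (hpP : ¬ p ∣ Nat.card H) (hPH : Subgroup.IsComplement' P H)
    (h : IsPermutable H) : ∃ N : Subgroup G, N.Normal ∧ Nat.card N = p := by
  have hp : p.Prime := Fact.out
  have hclosure := h.closure_eq hP hpP hPH
  have hcentral : ∀ g : G, (∀ y ∈ P, H ≤ Subgroup.normalizer (Subgroup.zpowers y : Set G) →
      Commute g y) → ∀ y ∈ P, Commute g y := by
    intro g hg y hy
    have hle : P ≤ Subgroup.centralizer {g} := by
      conv_lhs => rw [← hclosure]
      rw [Subgroup.closure_le]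
      intro z hz
      rw [SetLike.mem_coe, Subgroup.mem_centralizer_singleton_iff]
      exact (hg z hz.1 hz.2).symm
    exact (Subgroup.mem_centralizer_singleton_iff.mp (hle hy)).symm
  have hcommutator : ∀ x ∈ H, ∀ z ∈ H, ∀ y ∈ P, Commute (x * z * x⁻¹ * z⁻¹) y := fun x hx z hz =>
    hcentral _ fun y _ hy => commute_commutator_of_mem_normalizer_zpowers (hy hx) (hy hz)
  have hpow : ∀ x ∈ H, ∀ y ∈ P, Commute (x ^ (p - 1)) y := fun x hx =>
    hcentral _ fun y hyP hy => by
      obtain ⟨k, hk⟩ := IsPGroup.iff_orderOf.mp hP ⟨y, hyP⟩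
      rw [Subgroup.orderOf_mk] at hk
      refine commute_pow_of_mem_normalizer_zpowers hk (hy hx) ?_
      refine Nat.Coprime.coprime_dvd_left (Subgroup.orderOf_dvd_natCard H hx) ?_
      exact ((Nat.Prime.coprime_iff_not_dvd hp).mpr hpP).symm
  obtain ⟨N, ⟨hN, hNZ, hNbot⟩, hNmin⟩ :=
    (Set.toFinite {N : Subgroup G | N.Normal ∧ N ≤ centerIn P ∧ N ≠ ⊥}).exists_minimal
      ⟨centerIn P, inferInstance, le_rfl, centerIn_ne_bot hP hne⟩
  have hmin : ∀ M : Subgroup G, M.Normal → M ≤ N → M ≠ ⊥ → N ≤ M := fun M h1 h2 h3 =>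
    hNmin ⟨h1, h2.trans hNZ, h3⟩ h2
  have hNP : N ≤ P := fun x hx => (mem_centerIn.mp (hNZ hx)).1
  have hNcomm : ∀ x ∈ P, ∀ y ∈ N, x * y = y * x := fun x hx y hy => (mem_centerIn.mp (hNZ hy)).2 x hx
  let instN : CommGroup N :=
    { (inferInstance : Group N) with
      mul_comm := fun x y => Subtype.ext (hNcomm x (hNP x.2) y y.2) }
  have hNnt : Nontrivial N := (Subgroup.nontrivial_iff_ne_bot N).mpr hNbot
  have hNpow : ∀ y ∈ N, y ^ p = 1 := by
    -- The elements of N killed by p form a normal subgroup of G, nontrivial by Cauchy, so equal to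
    -- N by minimality.
    let E : Subgroup G := (powMonoidHom p : N →* N).ker.map N.subtype
    have hE : ∀ y, y ∈ E ↔ y ∈ N ∧ y ^ p = 1 := by
      intro y
      constructor
      · rintro ⟨z, hz, rfl⟩
        exact ⟨z.2, congrArg Subtype.val hz⟩
      · rintro ⟨hy, hyp⟩
        exact ⟨⟨y, hy⟩, Subtype.ext hyp, rfl⟩
    have hEn : E.Normal := ⟨fun y hy g => by
      rw [hE] at hy ⊢
      exact ⟨hN.conj_mem y hy.1 g, by rw [conj_pow, hy.2, mul_one, mul_inv_cancel]⟩⟩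
    have hpN : p ∣ Nat.card N :=
      (hP.to_le hNP).card_eq_or_dvd.resolve_left fun h => hNbot (Subgroup.card_eq_one.mp h)
    obtain ⟨z, hz⟩ := exists_prime_orderOf_dvd_card' p hpN
    have hEbot : E ≠ ⊥ := by
      intro hbot
      have hzE : (z : G) ∈ E :=
        (hE z).mpr ⟨z.2, by rw [← Subgroup.orderOf_coe] at hz; rw [← hz, pow_orderOf_eq_one]⟩
      rw [hbot, Subgroup.mem_bot] at hzE
      have : z = 1 := Subtype.ext hzE
      rw [this, orderOf_one] at hz
      exact hp.one_lt.ne hz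
    intro y hy
    exact ((hE y).mp (hmin E hEn (fun y hy => ((hE y).mp hy).1) hEbot hy)).2
  have hscalar : ∀ x ∈ H, ∃ k : ℕ, ∀ y ∈ N, x * y * x⁻¹ = y ^ k := by
    intro x hx
    let T : N →* N := (MulAut.conjNormal x).toMonoidHom
    have hTval : ∀ y : N, ((T y : N) : G) = x * y * x⁻¹ := fun y => MulAut.conjNormal_apply x y
    have hTpow : ∀ (n : ℕ) (y : N), ((T^[n] y : N) : G) = x ^ n * y * (x ^ n)⁻¹ := by
      intro n
      induction n with
      | zero => simp
      | succ n ih =>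
        intro y
        rw [Function.iterate_succ_apply', hTval, ih, pow_succ']
        group
    have hT : ∀ y, T^[p] y = T y := by
      intro y
      refine Subtype.ext ?_
      rw [hTpow, hTval]
      have hc : x ^ (p - 1) * (y : G) = y * x ^ (p - 1) := hpow x hx y (hNP y.2)
      have hpp : x ^ p = x * x ^ (p - 1) := by
        rw [← pow_succ', Nat.sub_add_cancel hp.one_lt.le]
      rw [hpp, mul_assoc x, hc]
      group
    obtain ⟨k, z, hz1, hz⟩ := exists_map_eq_pow (p := p)
      (fun y : N => Subtype.ext (hNpow y y.2)) T hT
    refine ⟨k, ?_⟩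
    -- The eigenspace of x for k. H preserves it because x and w induce commuting automorphisms for
    -- every w in H; P acts trivially on it.
    let S : Subgroup G :=
      { carrier := {y | y ∈ N ∧ x * y * x⁻¹ = y ^ k}
        one_mem' := ⟨N.one_mem, by simp⟩
        mul_mem' := by
          rintro a b ⟨ha, ha'⟩ ⟨hb, hb'⟩
          refine ⟨N.mul_mem ha hb, ?_⟩
          have hab : Commute a b := hNcomm a (hNP ha) b hb
          rw [hab.mul_pow, ← ha', ← hb']
          group
        inv_mem' := by
          rintro a ⟨ha, ha'⟩
          refine ⟨N.inv_mem ha, ?_⟩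
          rw [inv_pow, ← ha']
          group }
    have hSn : S.Normal := by
      refine sup_le_normalizer_normal hPH.sup_eq_top
        (le_normalizer_of_le_centerIn fun y hy => hNZ hy.1) ?_
      rw [Subgroup.le_normalizer_iff]
      rintro w hw y ⟨hy, hy'⟩
      refine ⟨hN.conj_mem y hy w, ?_⟩
      rw [conj_pow, ← hy']
      have hc : (x⁻¹ * w⁻¹ * x * w) * y = y * (x⁻¹ * w⁻¹ * x * w) := by
        have := hcommutator x⁻¹ (H.inv_mem hx) w⁻¹ (H.inv_mem hw) y (hNP hy)
        simpa using this.eq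
      calc x * (w * y * w⁻¹) * x⁻¹
          = w * x * ((x⁻¹ * w⁻¹ * x * w) * y) * w⁻¹ * x⁻¹ := by group
        _ = w * (x * y * x⁻¹) * w⁻¹ := by rw [hc]; group
    have hSbot : S ≠ ⊥ := by
      intro hbot
      have hzS : (z : G) ∈ S := ⟨z.2, by rw [← hTval, hz]; rfl⟩
      rw [hbot, Subgroup.mem_bot] at hzS
      exact hz1 (Subtype.ext hzS)
    intro y hy
    exact (hmin S hSn (fun y hy => hy.1) hSbot hy).2
  obtain ⟨z, hz⟩ := exists_ne (1 : N)
  refine ⟨Subgroup.zpowers (z : G), ?_, ?_⟩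
  · refine sup_le_normalizer_normal hPH.sup_eq_top
      (le_normalizer_of_le_centerIn (Subgroup.zpowers_le.mpr (hNZ z.2))) ?_
    rw [Subgroup.le_normalizer_iff]
    rintro x hx _ ⟨l, rfl⟩
    obtain ⟨k, hk⟩ := hscalar x hx
    simp only
    rw [← conj_zpow, hk z z.2]
    exact Subgroup.zpow_mem _ (Subgroup.pow_mem _ (Subgroup.mem_zpowers _) _) _
  · rw [Nat.card_zpowers]
    exact orderOf_eq_prime (hNpow z z.2) fun h => hz (Subtype.ext h)

end PermutableComplement

/-! ### Lifting Hall subgroups -/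

section HallLifting

variable {G : Type u} [Group G] [Finite G]

/-- Hall subgroups lift through quotients by normal subgroups of prime order. -/
theorem IsHall.exists_map_eq {N : Subgroup G} [N.Normal] (hp : (Nat.card N).Prime)
    {K' : Subgroup (G ⧸ N)} (hK' : IsHall K') :
    ∃ L : Subgroup G, IsHall L ∧ L.map (QuotientGroup.mk' N) = K' := by
  set p := Nat.card N with hpN
  have hsurj := QuotientGroup.mk'_surjective N
  set K := K'.comap (QuotientGroup.mk' N) with hK
  have hidx : K.index = K'.index := K'.index_comap_of_surjective hsurj
  have hG : Nat.card G = Nat.card K' * K'.index * p := by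
    rw [K'.card_mul_index, hpN]
    exact Subgroup.card_eq_card_quotient_mul_card_subgroup N
  have hidx0 : K'.index ≠ 0 := Subgroup.index_ne_zero_of_finite
  have hcard : Nat.card K = p * Nat.card K' := by
    refine Nat.eq_of_mul_eq_mul_right (Nat.pos_of_ne_zero hidx0) ?_
    rw [← hidx, K.card_mul_index, hG, hidx]
    ring
  -- The full preimage K is Hall unless p divides the index of `K'`. In that case p is prime to
  -- |`K'`|, and a Schur–Zassenhaus complement of N in K is a Hall subgroup with the same image.
  by_cases hpi : p.Coprime K'.index
  · refine ⟨K, ?_, Subgroup.map_comap_eq_self_of_surjective hsurj K'⟩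
    rw [IsHall, hcard, hidx]
    exact hpi.mul_left hK'
  · have hpdvd : p ∣ K'.index := by
      rwa [hp.coprime_iff_not_dvd, not_not] at hpi
    have hpK' : p.Coprime (Nat.card K') := (Nat.Coprime.coprime_dvd_right hpdvd hK').symm
    have hNK : N ≤ K := QuotientGroup.le_comap_mk' N K'
    have hNcard : Nat.card (N.subgroupOf K) = p :=
      Nat.card_congr (Subgroup.subgroupOfEquivOfLe hNK).toEquiv
    have hNidx : (N.subgroupOf K).index = Nat.card K' := by
      refine Nat.eq_of_mul_eq_mul_left hp.pos ?_
      rw [← hcard, ← (N.subgroupOf K).card_mul_index, hNcard]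
    obtain ⟨L, hL⟩ := Subgroup.exists_right_complement'_of_coprime (N := N.subgroupOf K)
      (by rwa [hNcard, hNidx])
    have hLcard : Nat.card (L.map K.subtype) = Nat.card K' := by
      rw [Subgroup.card_map_of_injective K.subtype_injective, ← hNidx, hL.symm.index_eq_card]
    refine ⟨L.map K.subtype, ?_, le_antisymm ?_ ?_⟩
    · have hLidx : (L.map K.subtype).index = K'.index * p := by
        refine Nat.eq_of_mul_eq_mul_left (Nat.card_pos (α := K')) ?_
        rw [← mul_assoc, ← hG, ← (L.map K.subtype).card_mul_index, hLcard]
      rw [IsHall, hLcard, hLidx]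
      exact Nat.Coprime.mul_right hK' hpK'.symm
    · rw [Subgroup.map_le_iff_le_comap]
      exact Subgroup.map_subtype_le L
    · intro x hx
      obtain ⟨g, rfl⟩ := hsurj x
      obtain ⟨⟨m, l⟩, hml⟩ := hL.2 ⟨g, hx⟩
      refine ⟨((l : K) : G), ⟨l, l.2, rfl⟩, ?_⟩
      have hg : ((m : K) : G) * ((l : K) : G) = g := congrArg Subtype.val hml
      have hm : QuotientGroup.mk' N ((m : K) : G) = 1 := (QuotientGroup.eq_one_iff _).mpr m.2
      rw [← hg, map_mul, hm, one_mul]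

end HallLifting

/-! ### From the Hall condition to supersolubility -/

theorem isHall_sylow {G : Type u} [Group G] [Finite G] {p : ℕ} [Fact p.Prime] (P : Sylow p G) :
    IsHall (P : Subgroup G) :=
  P.card_coprime_index

/-- A nontrivial finite group in which every Hall subgroup is `ℙ`-subnormal or permutable has a
normal subgroup of prime order. -/
theorem exists_normal_card_prime_of_hall {G : Type u} [Group G] [Finite G] [Nontrivial G]
    (h : ∀ H : Subgroup G, IsHall H → IsPrimeSubnormal H ∨ IsPermutable H) :
    ∃ N : Subgroup G, N.Normal ∧ (Nat.card N).Prime := by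
  have hne : (Nat.card G).primeFactors.Nonempty :=
    Nat.nonempty_primeFactors.mpr Finite.one_lt_card
  obtain ⟨p, hpmem, hpmax⟩ := (Nat.card G).primeFactors.exists_max_image id hne
  have hp : p.Prime := Nat.prime_of_mem_primeFactors hpmem
  have : Fact p.Prime := ⟨hp⟩
  have hmax : ∀ q : ℕ, q.Prime → q ∣ Nat.card G → q ≤ p := fun q hq hqG =>
    hpmax q (Nat.mem_primeFactors.mpr ⟨hq, hqG, Nat.card_pos.ne'⟩)
  obtain ⟨P⟩ : Nonempty (Sylow p G) := inferInstance
  have hPn : (P : Subgroup G).Normal :=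
    (h P (isHall_sylow P)).elim (·.sylow_normal hmax) (·.sylow_normal hmax)
  have hPne : (P : Subgroup G) ≠ ⊥ := P.ne_bot_of_dvd_card (Nat.dvd_of_mem_primeFactors hpmem)
  obtain ⟨H, hPH⟩ := Subgroup.exists_right_complement'_of_coprime (isHall_sylow P)
  have hHcard : Nat.card H = (P : Subgroup G).index := hPH.symm.index_eq_card.symm
  have hpH : ¬ p ∣ Nat.card H := hHcard ▸ P.not_dvd_index
  have hHall : IsHall H := by
    rw [IsHall, hHcard, hPH.index_eq_card]
    exact (isHall_sylow P).symm
  have : ∃ N : Subgroup G, N.Normal ∧ Nat.card N = p :=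
    (h H hHall).elim (·.exists_normal_card_eq P.isPGroup' hPne hPH)
      (·.exists_normal_card_eq P.isPGroup' hPne hpH hPH)
  obtain ⟨N, hN, hcard⟩ := this
  exact ⟨N, hN, hcard ▸ hp⟩

theorem isSupersoluble_of_hall (n : ℕ) {G : Type u} [Group G] [Finite G] (hn : Nat.card G = n)
    (h : ∀ H : Subgroup G, IsHall H → IsPrimeSubnormal H ∨ IsPermutable H) : IsSupersoluble G := by
  induction n using Nat.strong_induction_on generalizing G with
  | _ n ih =>
    rcases subsingleton_or_nontrivial G with hs | hnt
    · exact isSupersoluble_of_subsingleton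
    · obtain ⟨N, hN, hp⟩ := exists_normal_card_prime_of_hall h
      have : Fact (Nat.card N).Prime := ⟨hp⟩
      have : IsCyclic N := isCyclic_of_prime_card rfl
      refine isSupersoluble_of_quotient N (ih _ ?_ rfl fun K' hK' => ?_)
      · rw [← hn, Subgroup.card_eq_card_quotient_mul_card_subgroup N]
        exact lt_mul_of_one_lt_right Nat.card_pos hp.one_lt
      · obtain ⟨L, hL, rfl⟩ := hK'.exists_map_eq hp
        exact (h L hL).imp (·.map (QuotientGroup.mk'_surjective N))
          (·.map (QuotientGroup.mk'_surjective N))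

end HallSupersoluble

theorem corollary3p2 (G : Type*) [Group G] [Finite G] :
    List.TFAE
      [HallSupersoluble.IsSupersoluble G,
        ∀ H : Subgroup G, HallSupersoluble.IsHall H →
          HallSupersoluble.IsPrimeSubnormal H ∨ HallSupersoluble.IsStronglyPermutable H,
        ∀ H : Subgroup G, HallSupersoluble.IsHall H →
          HallSupersoluble.IsPrimeSubnormal H ∨ HallSupersoluble.IsPermutable H] := by
  tfae_have 1 → 2 := fun h H _ => Or.inl (h.isPrimeSubnormal _ rfl H)
  -- Permutability is the case U = G of strong permutability.
  tfae_have 2 → 3 := fun h H hH => (h H hH).imp_right fun hs => hs ⊤ le_top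
  tfae_have 3 → 1 := fun h => HallSupersoluble.isSupersoluble_of_hall _ rfl h
  tfae_finish
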